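/- Let $k$ be a field. Let $\mathcal{C}$ be the category whose objects are the finite sets, in which a morphism from $X$ to $Y$ (a correspondence) is a subset of $Y \times X$, in which the composite of $S \subseteq Y \times X$ followed by $R \subseteq Z \times Y$ is $RS = \{(z,x) \mid \exists\, y \in Y,\ (z,y) \in R \text{ and } (y,x) \in S\}$, and in which the identity of $X$ is the diagonal of $X \times X$. Let $k\mathcal{C}$ be its $k$-linearization: it has the same objects, the morphisms from $X$ to $Y$ form the free $k$-module $k\mathcal{C}(Y,X)$ with basis the set of correspondences from $X$ to $Y$, and composition is extended $k$-bilinearly. A correspondence functor over $k$ is a $k$-linear functor from $k\mathcal{C}$ to the category of $k$-modules. A correspondence functor $M$ is called finitely generated if there are finitely many finite sets $E_1, \dots, E_n$ ($n \ge 0$) and elements $m_i \in M(E_i)$ such that, for every finite set $X$, every element of $M(X)$ is of the form $\sum_{j \in J} M(\alpha_j)(m_j)$ with $J \subseteq \{1, \dots, n\}$ and $\alpha_j \in k\mathcal{C}(X, E_j)$ for $j\in J$. Theorem. Let $M$ be a correspondence functor over the field $k$. The following are equivalent: (a) $M$ is finitely generated. (b) There exist positive real numbers $a, b, r$ such that,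 for every finite set $X$ with $|X| \ge r$, the $k$-vector space $M(X)$ is finite-dimensional and $\dim_k M(X) \le a\, b^{|X|}$. -/

import Mathlib

open CategoryTheory

universe u v w

/-- A finite set (an object of the category of finite sets and correspondences). -/
structure FinCorr : Type (u + 1) where
  /-- The underlying finite set. -/
  carrier : Type u
  [finite : Finite carrier]

attribute [instance] FinCorr.finite

namespace FinCorr

/-- A correspondence from `X` to `Y` is a subset of `Y × X`. -/
@[ext]
structure Hom (X Y : FinCorr.{u}) : Type u where
  /-- The underlying subset of `Y × X`. -/
  rel : Set (Y.carrier × X.carrier)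

/-- The category of finite sets and correspondences: the identity of `X` is the diagonal of
`X × X`, and the composite of `S ⊆ Y × X` followed by `R ⊆ Z × Y` is
`R S = {(z, x) | ∃ y, (z, y) ∈ R ∧ (y, x) ∈ S}`. -/
instance : Category.{u} FinCorr.{u} where
  Hom X Y := Hom X Y
  id X := ⟨{p | p.1 = p.2}⟩
  comp S R := ⟨{p | ∃ y, (p.1, y) ∈ R.rel ∧ (y, p.2) ∈ S.rel}⟩
  id_comp S := by
    apply Hom.ext
    ext ⟨y, x⟩
    simp
  comp_id S := by
    apply Hom.ext
    ext ⟨y, x⟩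
    simp
  assoc S R T := by
    apply Hom.ext
    ext ⟨z, x⟩
    constructor
    · rintro ⟨y, hT, y', hR, hS⟩
      exact ⟨y', ⟨y, hT, hR⟩, hS⟩
    · rintro ⟨y', ⟨y, hT, hR⟩, hS⟩
      exact ⟨y, hT, y', hR, hS⟩

end FinCorr

/-- A correspondence functor over `k`: a `k`-linear functor from the `k`-linearization of the
category of finite sets and correspondences to the category of `k`-modules. -/
structure CorrespondenceFunctor (k : Type w) [CommRing k] where
  /-- The underlying functor on the linearization. -/
  toFunctor : Free k FinCorr.{u} ⥤ ModuleCat.{v} k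
  [additive : toFunctor.Additive]
  [linear : toFunctor.Linear k]

attribute [instance] CorrespondenceFunctor.additive CorrespondenceFunctor.linear

namespace CorrespondenceFunctor

variable {k : Type w} [CommRing k]

/-- The evaluation `M(X)` of a correspondence functor at a finite set. -/
abbrev eval (M : CorrespondenceFunctor.{u, v, w} k) (X : FinCorr.{u}) : ModuleCat.{v} k :=
  M.toFunctor.obj (Free.of k X)

/-- The family of elements `m i ∈ M(E i)` generates `M`: every element of every evaluation `M(X)`
is a finite sum `∑ α j · m j`, where `α j` is a `k`-linear combination of correspondences from
`E j` to `X`. -/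
def IsGeneratedBy (M : CorrespondenceFunctor.{u, v, w} k) {ι : Type*} (E : ι → FinCorr.{u})
    (m : ∀ i, M.eval (E i)) : Prop :=
  ∀ (X : FinCorr.{u}) (x : M.eval X),
    ∃ (J : Finset ι) (α : ∀ j, Free.of k (E j) ⟶ Free.of k X),
      x = ∑ j ∈ J, (M.toFunctor.map (α j)).hom (m j)

/-- `M` is finitely generated: it is generated by a finite family of elements of evaluations. -/
def IsFinitelyGenerated (M : CorrespondenceFunctor.{u, v, w} k) : Prop :=
  ∃ (n : ℕ) (E : Fin n → FinCorr.{u}) (m : ∀ i, M.eval (E i)), M.IsGeneratedBy E m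

end CorrespondenceFunctor

/-! ### Calculus of correspondences by rows. -/

namespace FinCorr

/-! Correspondences from E to X number at most 2^(|E||X|), so finite generation forces exponential
growth. Conversely, suppose M(E) is not spanned by images from smaller sets. Among reflexive
relations on E acting nontrivially modulo these images, a maximal R has distinct rows, since equal
rows would let R factor through a smaller set. Pushing a suitable R·v into M(E ⊔ Y) along each map φ
: Y → E gives |E|^|Y| vectors; pulling back along ψ yields a triangular system modulo the images
from below, so they are independent (`pow_card_le_finrank`). A bound a·b^|X| thus forces |E| ≤ b: M
is generated by its values on sets of size at most b, finite-dimensional as retracts of values on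
large sets. -/

/-- The graph of a map, as a correspondence. -/
def graph {X Y : FinCorr.{u}} (f : X.carrier → Y.carrier) : X ⟶ Y :=
  (⟨{p | p.1 = f p.2}⟩ : Hom X Y)

/-- The opposite of the graph of a map, as a correspondence. -/
def cograph {X Y : FinCorr.{u}} (f : X.carrier → Y.carrier) : Y ⟶ X :=
  (⟨{p | p.2 = f p.1}⟩ : Hom Y X)

/-- The set of elements related to `y` by a correspondence. -/
def row {X Y : FinCorr.{u}} (R : X ⟶ Y) (y : Y.carrier) : Set X.carrier :=
  {x | (y, x) ∈ Hom.rel R}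

theorem hom_ext_row {X Y : FinCorr.{u}} {R S : X ⟶ Y} (h : ∀ y, row R y = row S y) : R = S := by
  apply Hom.ext
  ext ⟨y, x⟩
  exact Set.ext_iff.1 (h y) x

theorem mem_row_comp {X Y Z : FinCorr.{u}} (S : X ⟶ Y) (R : Y ⟶ Z) (z : Z.carrier)
    (x : X.carrier) : x ∈ row (S ≫ R) z ↔ ∃ y, y ∈ row R z ∧ x ∈ row S y :=
  Iff.rfl

theorem mem_row_id {X : FinCorr.{u}} (x y : X.carrier) : x ∈ row (𝟙 X) y ↔ y = x :=
  Iff.rfl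

theorem mem_row_graph {X Y : FinCorr.{u}} (f : X.carrier → Y.carrier) (x : X.carrier)
    (y : Y.carrier) : x ∈ row (graph f) y ↔ y = f x :=
  Iff.rfl

theorem mem_row_cograph {X Y : FinCorr.{u}} (f : X.carrier → Y.carrier) (x : X.carrier)
    (y : Y.carrier) : y ∈ row (cograph f) x ↔ y = f x :=
  Iff.rfl

theorem graph_comp_cograph {X Y : FinCorr.{u}} {f : X.carrier → Y.carrier}
    (hf : Function.Injective f) : graph f ≫ cograph f = 𝟙 X := by
  refine hom_ext_row fun y => Set.ext fun x => ?_
  simp [mem_row_comp, mem_row_id, mem_row_graph, mem_row_cograph, hf.eq_iff]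

instance (X Y : FinCorr.{u}) : Finite (X ⟶ Y) :=
  Finite.of_injective (fun R : X ⟶ Y => Hom.rel R) fun _ _ h => Hom.ext h

theorem card_hom_le (X Y : FinCorr.{u}) :
    Nat.card (X ⟶ Y) ≤ 2 ^ (Nat.card Y.carrier * Nat.card X.carrier) := by
  have := Fintype.ofFinite (Y.carrier × X.carrier)
  rw [← Nat.card_prod, Nat.card_eq_fintype_card (α := Y.carrier × X.carrier),
    ← Fintype.card_set, ← Nat.card_eq_fintype_card]
  exact Nat.card_le_card_of_injective (fun R : X ⟶ Y => Hom.rel R) fun _ _ h => Hom.ext h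

/-- A correspondence with two equal rows factors through a smaller set. -/
theorem exists_factor_of_row_eq {E : FinCorr.{u}} (R : E ⟶ E) {y₁ y₂ : E.carrier}
    (hne : y₁ ≠ y₂) (h : row R y₁ = row R y₂) :
    ∃ (F : FinCorr.{u}) (S : E ⟶ F) (T : F ⟶ E),
      Nat.card F.carrier < Nat.card E.carrier ∧ S ≫ T = R := by
  classical
  let F : FinCorr.{u} := ⟨{y : E.carrier // y ≠ y₂}⟩
  let p : E.carrier → F.carrier := fun y => if hy : y = y₂ then ⟨y₁, hne⟩ else ⟨y, hy⟩
  refine ⟨F, R ≫ cograph (X := F) (Y := E) Subtype.val, cograph p, ?_, ?_⟩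
  · exact Finite.card_subtype_lt (p := fun y => y ≠ y₂) (x := y₂) (by simp)
  · refine hom_ext_row fun y => Set.ext fun x => ?_
    simp only [mem_row_comp, mem_row_cograph, exists_eq_left]
    by_cases hy : y = y₂
    · subst hy
      simp [p, h]
    · simp [p, hy]

/-- The disjoint union of two finite sets. -/
def sum (E Y : FinCorr.{u}) : FinCorr.{u} := ⟨E.carrier ⊕ Y.carrier⟩

/-- The map from the disjoint union extending a map by the identity. -/
def extend {E Y : FinCorr.{u}} (φ : Y.carrier → E.carrier) : (sum E Y).carrier → E.carrier :=
  Sum.elim id φ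

/-- The composite always contains R, and equals R exactly when the row of φ y lies in that of ψ y
for all y. This is the source of triangularity. -/
theorem mem_row_extend {E Y : FinCorr.{u}} (R : E ⟶ E) (φ ψ : Y.carrier → E.carrier)
    (e x : E.carrier) :
    x ∈ row (R ≫ cograph (extend φ) ≫ graph (extend ψ)) e ↔
      x ∈ row R e ∨ ∃ y, e = ψ y ∧ x ∈ row R (φ y) := by
  rw [← Category.assoc]
  simp only [mem_row_comp, mem_row_graph, mem_row_cograph, exists_eq_left]
  constructor
  · rintro ⟨e' | y, h, hx⟩
    · exact Or.inl (by cases h; exact hx)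
    · exact Or.inr ⟨y, h, hx⟩
  · rintro (hx | ⟨y, h, hx⟩)
    · exact ⟨Sum.inl e, rfl, hx⟩
    · exact ⟨Sum.inr y, h, hx⟩

/-- The standard set with `n` elements. -/
def std (n : ℕ) : FinCorr.{u} := ⟨ULift.{u} (Fin n)⟩

theorem card_std (n : ℕ) : Nat.card (std.{u} n).carrier = n := by
  simp [std]

end FinCorr

/-! ### Finite generation and exponential growth. -/

namespace CorrespondenceFunctor

open FinCorr

variable {k : Type w} [Field k] (M : CorrespondenceFunctor.{u, v, w} k)

/-- A correspondence, as a morphism of the linearization. -/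
noncomputable def basisHom (k : Type w) [Field k] {X Y : FinCorr.{u}} (f : X ⟶ Y) :
    Free.of k X ⟶ Free.of k Y :=
  (Free.embedding k FinCorr.{u}).map f

/-- The action of a correspondence. -/
noncomputable def act {X Y : FinCorr.{u}} (f : X ⟶ Y) : M.eval X →ₗ[k] M.eval Y :=
  (M.toFunctor.map (basisHom k f)).hom

theorem act_id (X : FinCorr.{u}) (x : M.eval X) : M.act (𝟙 X) x = x := by
  have h : basisHom k (𝟙 X) = 𝟙 (Free.of k X) := (Free.embedding k FinCorr.{u}).map_id X
  rw [act, h, M.toFunctor.map_id]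
  rfl

theorem act_comp {X Y Z : FinCorr.{u}} (f : X ⟶ Y) (g : Y ⟶ Z) (x : M.eval X) :
    M.act (f ≫ g) x = M.act g (M.act f x) := by
  have h : basisHom k (f ≫ g) = basisHom k f ≫ basisHom k g :=
    (Free.embedding k FinCorr.{u}).map_comp f g
  rw [act, h, M.toFunctor.map_comp]
  rfl

theorem map_mem_span {X Y : FinCorr.{u}} (α : Free.of k X ⟶ Free.of k Y) (x : M.eval X) :
    (M.toFunctor.map α).hom x ∈ Submodule.span k (Set.range fun f : X ⟶ Y => M.act f x) := by
  induction α using Finsupp.induction_linear with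
  | zero =>
    erw [M.toFunctor.map_zero]
    exact zero_mem _
  | add α β hα hβ =>
    erw [M.toFunctor.map_add]
    exact add_mem hα hβ
  | single f c =>
    have h : (Finsupp.single f c : Free.of k X ⟶ Free.of k Y) = c • basisHom k f :=
      (Finsupp.smul_single_one f c).symm
    erw [h, M.toFunctor.map_smul]
    exact Submodule.smul_mem _ _ (Submodule.subset_span ⟨f, rfl⟩)

theorem isGeneratedBy_iff {ι : Type*} [Finite ι] (E : ι → FinCorr.{u}) (m : ∀ i, M.eval (E i)) :
    M.IsGeneratedBy E m ↔ ∀ X : FinCorr.{u},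
      Submodule.span k (Set.range fun p : (Σ i, E i ⟶ X) => M.act p.2 (m p.1)) = ⊤ := by
  classical
  have := Fintype.ofFinite ι
  constructor
  · intro h X
    refine eq_top_iff.2 fun x _ => ?_
    obtain ⟨J, α, rfl⟩ := h X x
    refine Submodule.sum_mem _ fun j _ => ?_
    refine Submodule.span_mono ?_ (M.map_mem_span (α j) (m j))
    rintro _ ⟨f, rfl⟩
    exact ⟨⟨j, f⟩, rfl⟩
  · intro h X x
    refine ⟨Finset.univ, ?_⟩
    have hx : x ∈ Submodule.span k
        (Set.range fun p : (Σ i, E i ⟶ X) => M.act p.2 (m p.1)) := by rw [h X]; trivial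
    induction hx using Submodule.span_induction with
    | mem x hx =>
      obtain ⟨⟨i, f⟩, rfl⟩ := hx
      refine ⟨fun j => if hj : i = j then
        hj ▸ basisHom k f else 0, ?_⟩
      rw [Finset.sum_eq_single i]
      · simp [act]
      · intro j _ hj
        simp [hj.symm]
      · simp
    | zero => exact ⟨fun _ => 0, by simp⟩
    | add x y _ _ hx hy =>
      obtain ⟨α, rfl⟩ := hx
      obtain ⟨β, rfl⟩ := hy
      exact ⟨fun j => α j + β j, by simp [Finset.sum_add_distrib]⟩
    | smul c x _ hx =>
      obtain ⟨α, rfl⟩ := hx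
      exact ⟨fun j => c • α j, by simp [M.toFunctor.map_smul, Finset.smul_sum]⟩

theorem IsFinitelyGenerated.exists_finrank_le {M : CorrespondenceFunctor.{u, v, w} k}
    (h : M.IsFinitelyGenerated) :
    ∃ a b r : ℝ, 0 < a ∧ 0 < b ∧ 0 < r ∧
      ∀ X : FinCorr.{u}, r ≤ (Nat.card X.carrier : ℝ) →
        FiniteDimensional k (M.eval X) ∧
          (Module.finrank k (M.eval X) : ℝ) ≤ a * b ^ Nat.card X.carrier := by
  obtain ⟨n, E, m, h⟩ := h
  rw [isGeneratedBy_iff] at h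
  let c := ∑ i, Nat.card (E i).carrier
  -- `n + 1` rather than `n` keeps the constant positive for an empty family.
  refine ⟨n + 1, 2 ^ c, 1, by positivity, by positivity, one_pos, fun X _ => ⟨?_, ?_⟩⟩
  · exact Module.finite_def.2 ⟨(Set.finite_range _).toFinset, by simpa using h X⟩
  · have h₁ : Module.finrank k (M.eval X) ≤ Nat.card (Σ i, E i ⟶ X) := by
      have := Fintype.ofFinite (Σ i, E i ⟶ X)
      rw [← finrank_top, ← h X, Nat.card_eq_fintype_card]
      exact finrank_range_le_card _
    have h₂ : Nat.card (Σ i, E i ⟶ X) ≤ n * (2 ^ c) ^ Nat.card X.carrier := by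
      rw [Nat.card_sigma]
      calc ∑ i, Nat.card (E i ⟶ X) ≤ ∑ _i : Fin n, (2 ^ c) ^ Nat.card X.carrier := by
            refine Finset.sum_le_sum fun i _ => (card_hom_le _ _).trans ?_
            rw [← pow_mul, mul_comm c]
            refine Nat.pow_le_pow_right two_pos (Nat.mul_le_mul_left _ ?_)
            exact Finset.single_le_sum (f := fun i => Nat.card (E i).carrier)
              (fun _ _ => Nat.zero_le _) (Finset.mem_univ i)
        _ = _ := by simp
    calc (Module.finrank k (M.eval X) : ℝ) ≤ (n * (2 ^ c) ^ Nat.card X.carrier : ℕ) :=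
          mod_cast h₁.trans h₂
      _ ≤ (n + 1) * (2 ^ c) ^ Nat.card X.carrier := by
          push_cast
          gcongr
          linarith

/-! ### Generation from below. -/

/-- The submodule of `M(X)` generated by the evaluations at sets with fewer than `n` elements. -/
def fromBelow (n : ℕ) (X : FinCorr.{u}) : Submodule k (M.eval X) :=
  Submodule.span k {x | ∃ (F : FinCorr.{u}) (f : F ⟶ X) (m : M.eval F),
    Nat.card F.carrier < n ∧ M.act f m = x}

variable {M}

theorem act_mem_fromBelow {n : ℕ} {F X : FinCorr.{u}} (f : F ⟶ X) (m : M.eval F)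
    (h : Nat.card F.carrier < n) : M.act f m ∈ M.fromBelow n X :=
  Submodule.subset_span ⟨F, f, m, h, rfl⟩

theorem act_mem_fromBelow_of_mem {n : ℕ} {X Y : FinCorr.{u}} (f : X ⟶ Y) {x : M.eval X}
    (hx : x ∈ M.fromBelow n X) : M.act f x ∈ M.fromBelow n Y := by
  induction hx using Submodule.span_induction with
  | mem x hx =>
    obtain ⟨F, g, m, h, rfl⟩ := hx
    rw [← act_comp]
    exact act_mem_fromBelow _ _ h
  | zero => simp
  | add x y _ _ hx hy => simpa using add_mem hx hy
  | smul c x _ hx => simpa using Submodule.smul_mem _ c hx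

/-- If `M(E)` is not generated from below, some reflexive relation on `E`, maximal among those
that act nontrivially modulo elements from below, has pairwise distinct rows. -/
theorem exists_maximal_reflexive {E : FinCorr.{u}}
    (hE : M.fromBelow (Nat.card E.carrier) E ≠ ⊤) :
    ∃ (R : E ⟶ E) (v : M.eval E), Function.Injective (row R) ∧
      M.act R v ∉ M.fromBelow (Nat.card E.carrier) E ∧
      ∀ S : E ⟶ E, (∀ e, row R e ⊆ row S e) → (∃ e, ¬ row S e ⊆ row R e) →
        M.act S v ∈ M.fromBelow (Nat.card E.carrier) E := by
  let I := M.fromBelow (Nat.card E.carrier) E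
  let A : Set (E ⟶ E) := {R | (∀ e, e ∈ row R e) ∧ ∃ v, M.act R v ∉ I}
  have hA : A.Nonempty := by
    obtain ⟨v, hv⟩ : ∃ v, v ∉ I := by
      by_contra! h
      exact hE (eq_top_iff.2 fun x _ => h x)
    exact ⟨𝟙 E, fun e => rfl, v, by rwa [act_id]⟩
  obtain ⟨R, ⟨hr, v, hv⟩, hmax⟩ := (Set.toFinite A).exists_maximalFor row A hA
  refine ⟨R, v, fun y₁ y₂ h => ?_, hv, fun S hRS hSR => ?_⟩
  · by_contra hne
    obtain ⟨F, S, T, hF, rfl⟩ := exists_factor_of_row_eq R hne h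
    rw [act_comp] at hv
    exact hv (act_mem_fromBelow _ _ hF)
  · by_contra hS
    obtain ⟨e, he⟩ := hSR
    -- A relation containing R is still reflexive, so the same v would contradict maximality of R.
    exact he (hmax ⟨fun e => hRS e (hr e), v, hS⟩ hRS e)

/-- If `M(E)` is not generated from below, then `M` grows at least like `|E| ^ |Y|`. -/
theorem pow_card_le_finrank {E : FinCorr.{u}} (hE : M.fromBelow (Nat.card E.carrier) E ≠ ⊤)
    (Y : FinCorr.{u}) [FiniteDimensional k (M.eval (sum E Y))] :
    Nat.card E.carrier ^ Nat.card Y.carrier ≤ Module.finrank k (M.eval (sum E Y)) := by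
  classical
  obtain ⟨R, v, hinj, hv, hmax⟩ := exists_maximal_reflexive hE
  set I := M.fromBelow (Nat.card E.carrier) E
  have := Fintype.ofFinite (Y.carrier → E.carrier)
  have hli : LinearIndependent k fun φ : Y.carrier → E.carrier =>
      M.act (cograph (extend φ)) (M.act R v) := by
    rw [Fintype.linearIndependent_iff]
    intro g hg
    by_contra! hne
    -- With ψ minimal in the support, every other φ there gives a relation strictly larger than R,
    -- which sends v into I; only the ψ term survives modulo I.
    obtain ⟨ψ, hψ, hmin⟩ := (Set.toFinite {φ | g φ ≠ 0}).exists_minimalFor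
      (fun φ y => row R (φ y)) _ hne
    have hsum := congrArg (M.act (graph (extend ψ))) hg
    simp only [map_sum, map_smul, map_zero, ← act_comp] at hsum
    rw [Finset.sum_eq_add_sum_sdiff_singleton_of_mem (Finset.mem_univ ψ)] at hsum
    have hψR : R ≫ cograph (extend ψ) ≫ graph (extend ψ) = R := by
      refine hom_ext_row fun e => Set.ext fun x => ?_
      rw [mem_row_extend]
      constructor
      · rintro (h | ⟨y, rfl, h⟩) <;> exact h
      · exact Or.inl
    have hrest : ∀ φ ∈ Finset.univ \ {ψ},
        g φ • M.act ((R ≫ cograph (extend φ)) ≫ graph (extend ψ)) v ∈ I := by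
      intro φ hφ
      by_cases h0 : g φ = 0
      · simp [h0]
      refine Submodule.smul_mem _ _ (hmax _ (fun e x hx => ?_) ?_)
      · rw [Category.assoc, mem_row_extend]
        exact Or.inl hx
      · by_contra! hle
        have h₁ : (fun y => row R (φ y)) ≤ fun y => row R (ψ y) := fun y x hx => by
          refine hle (ψ y) ?_
          rw [Category.assoc, mem_row_extend]
          exact Or.inr ⟨y, rfl, hx⟩
        have h₂ := le_antisymm h₁ (hmin h0 h₁)
        have : φ = ψ := funext fun y => hinj (congrFun h₂ y)
        simp [this] at hφ
    have hmem : g ψ • M.act R v ∈ I := by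
      rw [Category.assoc, hψR] at hsum
      rw [eq_neg_of_add_eq_zero_left hsum]
      exact neg_mem (Submodule.sum_mem _ hrest)
    exact hv ((Submodule.smul_mem_iff _ hψ).1 hmem)
  calc Nat.card E.carrier ^ Nat.card Y.carrier = Nat.card (Y.carrier → E.carrier) := by
        rw [Nat.card_fun]
    _ = Fintype.card (Y.carrier → E.carrier) := Nat.card_eq_fintype_card
    _ ≤ _ := hli.fintype_card_le_finrank

/-- Under an exponential bound with base `b`, evaluations at sets with more than `b` elements are
generated from below. -/
theorem fromBelow_eq_top {a b r : ℝ} (hb : 0 < b)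
    (h : ∀ X : FinCorr.{u}, r ≤ (Nat.card X.carrier : ℝ) → FiniteDimensional k (M.eval X) ∧
      (Module.finrank k (M.eval X) : ℝ) ≤ a * b ^ Nat.card X.carrier)
    (E : FinCorr.{u}) (hE : b < Nat.card E.carrier) :
    M.fromBelow (Nat.card E.carrier) E = ⊤ := by
  by_contra hne
  set e := Nat.card E.carrier
  -- For large n, (e/b)^n exceeds a·b^e, against e^n ≤ a·b^(e+n).
  have hlim := tendsto_pow_atTop_atTop_of_one_lt ((one_lt_div hb).2 hE)
  obtain ⟨n, hn, hrn⟩ := ((hlim.eventually_gt_atTop (a * b ^ e)).and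
    (Filter.eventually_ge_atTop ⌈r⌉₊)).exists
  have hcard : Nat.card (sum E (std n)).carrier = e + n := by
    change Nat.card (E.carrier ⊕ (std.{u} n).carrier) = _
    rw [Nat.card_sum, card_std]
  obtain ⟨_, hle⟩ := h (sum E (std n)) (by
    rw [hcard]
    push_cast
    have := Nat.ceil_le.1 hrn
    linarith [Nat.cast_nonneg (α := ℝ) e])
  have hge := pow_card_le_finrank hne (std n)
  rw [card_std] at hge
  rw [hcard, pow_add] at hle
  have hge' : (e : ℝ) ^ n ≤ a * (b ^ e * b ^ n) := le_trans (mod_cast hge) hle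
  rw [div_pow, lt_div_iff₀ (pow_pos hb n)] at hn
  linarith [mul_assoc a (b ^ e) (b ^ n)]

theorem fromBelow_eq_top_of_forall {N : ℕ}
    (h : ∀ E : FinCorr.{u}, N ≤ Nat.card E.carrier → M.fromBelow (Nat.card E.carrier) E = ⊤)
    (X : FinCorr.{u}) : M.fromBelow N X = ⊤ := by
  induction hn : Nat.card X.carrier using Nat.strong_induction_on generalizing X with
  | _ n ih =>
    subst hn
    by_cases hX : Nat.card X.carrier < N
    · exact eq_top_iff.2 fun x _ => M.act_id X x ▸ act_mem_fromBelow (𝟙 X) x hX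
    · rw [eq_top_iff, ← h X (not_lt.1 hX)]
      refine Submodule.span_le.2 ?_
      rintro _ ⟨F, f, m, hF, rfl⟩
      exact act_mem_fromBelow_of_mem f (by rw [ih _ hF F rfl]; trivial)

/-- An injection makes X a retract of Y, so M(X) is a quotient of M(Y). -/
theorem finiteDimensional_of_injective {X Y : FinCorr.{u}} {f : X.carrier → Y.carrier}
    (hf : Function.Injective f) [FiniteDimensional k (M.eval Y)] :
    FiniteDimensional k (M.eval X) :=
  Module.Finite.of_surjective (M.act (cograph f)) fun x =>
    ⟨M.act (graph f) x, by rw [← act_comp, graph_comp_cograph hf, act_id]⟩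

theorem isFinitelyGenerated_of_fromBelow {N : ℕ} (h : ∀ X, M.fromBelow N X = ⊤)
    (hfin : ∀ X : FinCorr.{u}, FiniteDimensional k (M.eval X)) : M.IsFinitelyGenerated := by
  let ι := Σ i : Fin N, Fin (Module.finrank k (M.eval (std i)))
  let E : ι → FinCorr.{u} := fun p => std p.1
  let m : ∀ p : ι, M.eval (E p) := fun p => Module.finBasis k (M.eval (std p.1)) p.2
  obtain ⟨n, ⟨e⟩⟩ := Finite.exists_equiv_fin ι
  refine ⟨n, fun i => E (e.symm i), fun i => m (e.symm i), (isGeneratedBy_iff _ _ _).2 fun X => ?_⟩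
  rw [eq_top_iff, ← h X]
  refine Submodule.span_le.2 ?_
  rintro _ ⟨F, f, x, hF, rfl⟩
  let g : F.carrier ≃ (std.{u} (Nat.card F.carrier)).carrier :=
    (Finite.equivFin F.carrier).trans Equiv.ulift.symm
  -- Transports x to the standard set of the same size, where a basis was chosen.
  rw [← M.act_id F x, ← graph_comp_cograph g.injective, act_comp, ← act_comp]
  generalize M.act (graph g) x = y
  generalize cograph g ≫ f = f'
  rw [← (Module.finBasis k (M.eval (std (Nat.card F.carrier)))).sum_repr y, map_sum]
  refine Submodule.sum_mem _ fun j _ => ?_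
  rw [map_smul]
  refine Submodule.smul_mem _ _ (Submodule.subset_span ?_)
  let p : ι := ⟨⟨Nat.card F.carrier, hF⟩, j⟩
  obtain ⟨i, hi⟩ : ∃ i, e.symm i = p := e.symm.surjective p
  suffices ∀ q : ι, q = p → ∃ f'' : E q ⟶ X, M.act f'' (m q) = M.act f' (m p) by
    obtain ⟨f'', hf''⟩ := this _ hi
    exact ⟨⟨i, f''⟩, hf''⟩
  rintro _ rfl
  exact ⟨f', rfl⟩

theorem isFinitelyGenerated_of_finrank_le {a b r : ℝ} (hb : 0 < b)
    (h : ∀ X : FinCorr.{u}, r ≤ (Nat.card X.carrier : ℝ) → FiniteDimensional k (M.eval X) ∧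
      (Module.finrank k (M.eval X) : ℝ) ≤ a * b ^ Nat.card X.carrier) :
    M.IsFinitelyGenerated := by
  -- This threshold makes N ≤ |E| equivalent to b < |E|.
  refine isFinitelyGenerated_of_fromBelow (N := ⌊b⌋₊ + 1)
    (fromBelow_eq_top_of_forall fun E hE => ?_) fun X => ?_
  · exact fromBelow_eq_top hb h E ((Nat.floor_lt hb.le).1 hE)
  · have := (h (sum X (std ⌈r⌉₊)) (by
      change r ≤ (Nat.card (X.carrier ⊕ (std.{u} ⌈r⌉₊).carrier) : ℝ)
      rw [Nat.card_sum, card_std]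
      push_cast
      linarith [Nat.le_ceil r, Nat.cast_nonneg (α := ℝ) (Nat.card X.carrier)])).1
    exact finiteDimensional_of_injective (Y := sum X (std ⌈r⌉₊)) (f := Sum.inl) Sum.inl_injective

end CorrespondenceFunctor

theorem mainTheorem1 {k : Type w} [Field k] (M : CorrespondenceFunctor.{u, v, w} k) :
    M.IsFinitelyGenerated ↔
      ∃ a b r : ℝ, 0 < a ∧ 0 < b ∧ 0 < r ∧
        ∀ X : FinCorr.{u}, r ≤ (Nat.card X.carrier : ℝ) →
          FiniteDimensional k (M.eval X) ∧
            (Module.finrank k (M.eval X) : ℝ) ≤ a * b ^ Nat.card X.carrier :=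
  ⟨fun h => h.exists_finrank_le, fun ⟨_, _, _, _, hb, _, h⟩ =>
    CorrespondenceFunctor.isFinitelyGenerated_of_finrank_le hb h⟩
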